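/- Conventions. Let $\mathcal C$ be a $\mathbb C$-linear ribbon category, i.e. a $\mathbb C$-linear braided rigid monoidal category (with bilinear tensor product) with braiding $\beta$ and a twist compatible with tensor products and duals. Let $X$ be an object with a self-duality (a cup $1\to X\otimes X$ and a cap $X\otimes X\to 1$ satisfying the zig-zag identities), and let $\tau$ be a trivalent vertex, i.e. a morphism $\mu\colon X\otimes X\to X$, regarded also, using the cap, as a morphism $X^{\otimes 3}\to 1$. Diagrams are read from bottom to top. Put $\mathcal C(n)=\operatorname{Hom}(X^{\otimes n},1)$. We call $(\mathcal C,X,\tau)$ a *trivalent ribbon category* if - $\mathcal C(1)=0$, and $\mathcal C(0)$, $\mathcal C(2)$, $\mathcal C(3)$ are one-dimensional, spanned by the empty diagram, the strand (i.e. the cap) and $\tau$ respectively; - $\mathcal C$ is generated by $\tau$ as a ribbon category: all morphisms between tensor powers of $X$ are linear combinations of diagrams built from crossings, cups, caps and $\tau$, and every object is a tensor power of $X$ up to finite direct sums and direct summands; - the circle (cup followed by cap) is a non-zero multiple $d$ of the empty diagram, and the bigon is a non-zero multiple $b$ of the strand. Let $\Delta\colon X\to X\otimes X$ be the vertex with one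 leg at the bottom and two at the top, obtained from $\mu$ by turning its second input into an output with a cup. In $\operatorname{End}(X\otimes X)$ let $\mathrm{id}$ be the identity, $U$ the cap followed by the cup, $I=\Delta\circ\mu$ (two vertices joined by a vertical edge), $H=(\mathrm{id}_X\otimes\mu)\circ(\Delta\otimes \mathrm{id}_X)$ (two vertical strands joined by a horizontal edge), $S=H\circ H$ (the square), $P=\beta_{X,X}^{-1}$ the negative crossing, and $K=P\circ H$. For $v\in\mathbb C^\times$ and $\alpha\in\mathbb C$, we say that $(\mathcal C,X,\tau)$ satisfies $(\mathrm{QEJac}\text{-}\alpha)$ with parameter $v$ if $$v^{-3}K+vI-v^{-1}H+\alpha\,\bigl(P+v^{4}U+v^{-4}\,\mathrm{id}\bigr)=0,$$ and, for the same $v$ and some $t\in\mathbb C$, the elementary relations hold: the circle is $d$, the lollipop (a vertex with two of its legs joined) is $0$, the bigon $\mu\circ\Delta$ is $b\cdot\mathrm{id}_X$, the triangle $\mu\circ H$ is $t\mu$, the twisted vertex $\mu\circ P$ is $-v^{6}\mu$, and $P\circ\mathrm{cup}=v^{12}\,\mathrm{cup}$. **Corollary 6.31.** Let $(\mathcal C,X,\tau)$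 be a trivalent ribbon category over $\mathbb C$ with $\dim\mathcal C(4)\le 5$ which satisfies $(\mathrm{QEJac}\text{-}\alpha)$ with $v=1$, for some $\alpha\in\mathbb C$. Then $\mathcal C$ is symmetric, i.e. $\beta_{Z,Y}\circ\beta_{Y,Z}=\mathrm{id}_{Y\otimes Z}$ for all objects $Y,Z$. Moreover $b\neq0$, $d\neq-2$, and, writing $\sigma=\beta_{X,X}$, $\mathcal C$ satisfies the relations of the classical exceptional series with $D=d$ and $B=b$: the circle is $d$, the lollipop is $0$, the bigon is $b\cdot \mathrm{id}_X$, the triangle is $\tfrac b2\,\mu$, $$\mu\circ\sigma=-\mu,\qquad \sigma\circ\mathrm{cup}=\mathrm{cup}\qquad\text{(antisymmetry of the vertex and symmetry of the form)},$$ $$I-H+\sigma\circ H=0\qquad\text{(Jacobi relation)},$$ $$S=\frac b6\,(I+H)+\frac56\,\frac{b^2}{2+d}\,\bigl(U+\mathrm{id}+\sigma\bigr)\qquad\text{(classical exceptional, or Cvitanović–Vogel, square relation)}.$$ -/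

import Mathlib

open CategoryTheory MonoidalCategory

universe w u

noncomputable section

/-- A ribbon category: a braided rigid monoidal category with a twist `θ`, a natural automorphism
of the identity functor such that `θ_{Y ⊗ Z} = (θ_Y ⊗ θ_Z) ≫ β_{Y,Z} ≫ β_{Z,Y}` and
`θ_{Y*} = (θ_Y)*`. (The dual `Yᘁ` comes with `𝟙_ ⟶ Y ⊗ Yᘁ` and `Yᘁ ⊗ Y ⟶ 𝟙_`; duals on the
other side are then supplied by the braiding.) -/
class RibbonCategory (C : Type u) [Category.{w} C] [MonoidalCategory C] [BraidedCategory C]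
    [RightRigidCategory C] where
  /-- The twist. -/
  twist : 𝟭 C ≅ 𝟭 C
  twist_tensor (Y Z : C) :
    twist.hom.app (Y ⊗ Z) =
      (twist.hom.app Y ⊗ₘ twist.hom.app Z) ≫ (β_ Y Z).hom ≫ (β_ Z Y).hom
  twist_dual (Y : C) : twist.hom.app (Yᘁ) = (twist.hom.app Y)ᘁ

/-- The tensor power `X ⊗ (X ⊗ (⋯ ⊗ X))` with `n` factors. -/
def boxObj {C : Type u} [Category.{w} C] [MonoidalCategory C] (X : C) : ℕ → C
  | 0 => 𝟙_ C
  | 1 => X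
  | n + 2 => X ⊗ boxObj X (n + 1)

/-- The `n`-box space `𝒞(n) = Hom(X^{⊗ n}, 1)`. -/
abbrev Box {C : Type u} [Category.{w} C] [MonoidalCategory C] (X : C) (n : ℕ) : Type w :=
  boxObj X n ⟶ 𝟙_ C

/-- What is needed to read trivalent graphs in a category: a self-duality of `X`
(a cup and a cap satisfying both zig-zag identities) and a trivalent vertex, drawn with two legs
at the bottom and one at the top. Neither symmetry of the self-duality nor rotational invariance
of the vertex is assumed. Diagrams are read from bottom to top. -/
structure TrivalentData {C : Type u} [Category.{w} C] [MonoidalCategory C] (X : C) where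
  /-- The self-duality. -/
  dual : ExactPairing X X
  /-- The trivalent vertex. -/
  mul : X ⊗ X ⟶ X

namespace TrivalentData

section Pictures

variable {C : Type u} [Category.{w} C] [MonoidalCategory C] {X : C} (T : TrivalentData X)

/-- The cup. -/
def cup : 𝟙_ C ⟶ X ⊗ X := T.dual.coevaluation'

/-- The cap. -/
def cap : X ⊗ X ⟶ 𝟙_ C := T.dual.evaluation'

/-- The strand as an element of the 2-box space. -/
def strandBox : Box X 2 := T.cap

/-- The trivalent vertex as an element of the 3-box space, its output turned into an input by a
cap on the right. -/
def vertexBox : Box X 3 := (α_ X X X).inv ≫ T.mul ▷ X ≫ T.cap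

/-- The trivalent vertex with one leg at the bottom and two at the top: the second input of `mul`
is turned into an output by a cup on the right. -/
def comul : X ⟶ X ⊗ X := (ρ_ X).inv ≫ X ◁ T.cup ≫ (α_ X X X).inv ≫ T.mul ▷ X

/-- The closed circle. -/
def circle : 𝟙_ C ⟶ 𝟙_ C := T.cup ≫ T.cap

/-- The lollipop: a vertex with two of its legs joined. -/
def lollipop : X ⟶ 𝟙_ C := T.comul ≫ T.cap

/-- The bigon. -/
def bigon : X ⟶ X := T.comul ≫ T.mul

/-- A cap below a cup. -/
def cupcap : X ⊗ X ⟶ X ⊗ X := T.cap ≫ T.cup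

/-- The diagram `I`: two vertices joined by a vertical edge. -/
def drawI : X ⊗ X ⟶ X ⊗ X := T.mul ≫ T.comul

/-- The diagram `H`: two vertical strands joined by a horizontal edge. -/
def drawH : X ⊗ X ⟶ X ⊗ X := T.comul ▷ X ≫ (α_ X X X).hom ≫ X ◁ T.mul

/-- The triangle with three external legs, two at the bottom and one at the top. -/
def triangle : X ⊗ X ⟶ X := T.drawH ≫ T.mul

/-- The square with four external legs. -/
def square : X ⊗ X ⟶ X ⊗ X := T.drawH ≫ T.drawH

end Pictures

section Braided

variable {C : Type u} [Category.{w} C] [MonoidalCategory C] [BraidedCategory C]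

/-- The negative crossing, i.e. the one given by the inverse of the braiding. -/
def negCross (X : C) : X ⊗ X ⟶ X ⊗ X := (β_ X X).inv

variable {X : C} (T : TrivalentData X)

/-- The diagram `H` followed by the negative crossing. -/
def crossX : X ⊗ X ⟶ X ⊗ X := T.drawH ≫ negCross X

/-- The diagram `H` followed by the braiding; it is used where the braiding is symmetric. -/
def symCrossX : X ⊗ X ⟶ X ⊗ X := T.drawH ≫ (β_ X X).hom

end Braided

end TrivalentData

/-- Bracketed words in one letter: the objects of the category of trivalent tangles. -/
inductive TangleWord : Type
  | unit : TangleWord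
  | strand : TangleWord
  | tensor : TangleWord → TangleWord → TangleWord

/-- The object of the category that a word denotes. -/
def TangleWord.obj {C : Type u} [Category.{w} C] [MonoidalCategory C] (X : C) : TangleWord → C
  | .unit => 𝟙_ C
  | .strand => X
  | .tensor a b => a.obj X ⊗ b.obj X

/-- Diagrams of knotted trivalent graphs, built from crossings, caps, cups and trivalent vertices
by vertical and horizontal composition (with rebracketing). -/
inductive TangleDiagram : TangleWord → TangleWord → Type
  | id (a : TangleWord) : TangleDiagram a a
  | comp {a b c : TangleWord} : TangleDiagram a b → TangleDiagram b c → TangleDiagram a c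
  | tensor {a b c d : TangleWord} :
      TangleDiagram a b → TangleDiagram c d → TangleDiagram (a.tensor c) (b.tensor d)
  | assoc (a b c : TangleWord) : TangleDiagram ((a.tensor b).tensor c) (a.tensor (b.tensor c))
  | assocInv (a b c : TangleWord) : TangleDiagram (a.tensor (b.tensor c)) ((a.tensor b).tensor c)
  | leftUnit (a : TangleWord) : TangleDiagram (TangleWord.unit.tensor a) a
  | leftUnitInv (a : TangleWord) : TangleDiagram a (TangleWord.unit.tensor a)
  | rightUnit (a : TangleWord) : TangleDiagram (a.tensor TangleWord.unit) a
  | rightUnitInv (a : TangleWord) : TangleDiagram a (a.tensor TangleWord.unit)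
  | posCross : TangleDiagram (TangleWord.strand.tensor TangleWord.strand)
      (TangleWord.strand.tensor TangleWord.strand)
  | negCross : TangleDiagram (TangleWord.strand.tensor TangleWord.strand)
      (TangleWord.strand.tensor TangleWord.strand)
  | cup : TangleDiagram TangleWord.unit (TangleWord.strand.tensor TangleWord.strand)
  | cap : TangleDiagram (TangleWord.strand.tensor TangleWord.strand) TangleWord.unit
  | vertex : TangleDiagram (TangleWord.strand.tensor TangleWord.strand) TangleWord.strand

/-- The morphism that a diagram denotes. -/
def TangleDiagram.eval {C : Type u} [Category.{w} C] [MonoidalCategory C] [BraidedCategory C]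
    {X : C} (T : TrivalentData X) :
    {a b : TangleWord} → TangleDiagram a b → (a.obj X ⟶ b.obj X)
  | _, _, .id a => 𝟙 (a.obj X)
  | _, _, .comp f g => f.eval T ≫ g.eval T
  | _, _, .tensor f g => f.eval T ⊗ₘ g.eval T
  | _, _, .assoc a b c => (α_ (a.obj X) (b.obj X) (c.obj X)).hom
  | _, _, .assocInv a b c => (α_ (a.obj X) (b.obj X) (c.obj X)).inv
  | _, _, .leftUnit a => (λ_ (a.obj X)).hom
  | _, _, .leftUnitInv a => (λ_ (a.obj X)).inv
  | _, _, .rightUnit a => (ρ_ (a.obj X)).hom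
  | _, _, .rightUnitInv a => (ρ_ (a.obj X)).inv
  | _, _, .posCross => (β_ X X).hom
  | _, _, .negCross => (β_ X X).inv
  | _, _, .cup => T.cup
  | _, _, .cap => T.cap
  | _, _, .vertex => T.mul

/-- The category is generated, as a `ℂ`-linear ribbon category, by the trivalent vertex: every
morphism between tensor powers of `X` is a linear combination of diagrams, and every object is,
up to finite direct sums and direct summands (which need not exist in the category), a tensor
power of `X`. The second clause allows both for categories whose objects are the tensor
powers of `X` and for their additive and idempotent completions, such as representation
categories. -/
structure GeneratedByVertex {C : Type u} [Category.{w} C] [MonoidalCategory C]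
    [BraidedCategory C] [Preadditive C] [Linear ℂ C] {X : C} (T : TrivalentData X) : Prop where
  morphisms : ∀ a b : TangleWord,
    Submodule.span ℂ (Set.range (TangleDiagram.eval T : TangleDiagram a b → _)) = ⊤
  objects : ∀ Y : C, ∃ (n : ℕ) (a : Fin n → TangleWord) (f : ∀ i, Y ⟶ (a i).obj X)
    (g : ∀ i, (a i).obj X ⟶ Y), ∑ i, f i ≫ g i = 𝟙 Y

/-- `(𝒞, X, τ)` is a trivalent ribbon category over `ℂ`. A vector space is free of rank one with
generator `x` if and only if `c ↦ c • x` is bijective. -/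
structure IsTrivalentRibbon {C : Type u} [Category.{w} C] [MonoidalCategory C]
    [BraidedCategory C] [RightRigidCategory C] [RibbonCategory C]
    [Preadditive C] [Linear ℂ C] [MonoidalPreadditive C] [MonoidalLinear ℂ C]
    {X : C} (T : TrivalentData X) : Prop where
  box_zero : Function.Bijective fun c : ℂ => c • (𝟙 (𝟙_ C) : Box X 0)
  box_one : ∀ f : Box X 1, f = 0
  box_two : Function.Bijective fun c : ℂ => c • T.strandBox
  box_three : Function.Bijective fun c : ℂ => c • T.vertexBox
  generated : GeneratedByVertex T
  circle_ne_zero : ∃ d : ℂ, d ≠ 0 ∧ T.circle = d • 𝟙 (𝟙_ C)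
  bigon_ne_zero : ∃ b : ℂ, b ≠ 0 ∧ T.bigon = b • 𝟙 X

/-- The elementary relations: circle `d`, lollipop `0`, bigon `b`, triangle `t`, twisted vertex
`-v⁶`, twisted cup `v¹²`. -/
structure ElementaryRelations {C : Type u} [Category.{w} C] [MonoidalCategory C]
    [BraidedCategory C] [Preadditive C] [Linear ℂ C] {X : C} (T : TrivalentData X)
    (v d b t : ℂ) : Prop where
  circle : T.circle = d • 𝟙 (𝟙_ C)
  lollipop : T.lollipop = 0
  bigon : T.bigon = b • 𝟙 X
  triangle : T.triangle = t • T.mul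
  twisted_vertex : TrivalentData.negCross X ≫ T.mul = (-v ^ 6) • T.mul
  twisted_cup : T.cup ≫ TrivalentData.negCross X = v ^ 12 • T.cup

/-- The quantum exceptional Jacobi relation with parameters `v`, `α`, together with the
elementary relations with the same `v`. -/
structure QuantumExceptionalJacobi {C : Type u} [Category.{w} C] [MonoidalCategory C]
    [BraidedCategory C] [Preadditive C] [Linear ℂ C] {X : C} (T : TrivalentData X)
    (v α d b t : ℂ) : Prop where
  v_ne_zero : v ≠ 0
  elementary : ElementaryRelations T v d b t
  jacobi :
    v ^ (-3 : ℤ) • T.crossX + v • T.drawI - v ^ (-1 : ℤ) • T.drawH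
      + α • (TrivalentData.negCross X + v ^ (4 : ℤ) • T.cupcap
        + v ^ (-4 : ℤ) • 𝟙 (X ⊗ X)) = 0

/-- The relations of the classical exceptional series with parameters `D`, `B`: the relations of
Jacobi diagrams and the classical exceptional (Cvitanović–Vogel) square relation. -/
structure ClassicalExceptionalRelations {C : Type u} [Category.{w} C] [MonoidalCategory C]
    [BraidedCategory C] [Preadditive C] [Linear ℂ C] {X : C} (T : TrivalentData X)
    (D B : ℂ) : Prop where
  B_ne_zero : B ≠ 0
  two_add_D_ne_zero : 2 + D ≠ 0
  circle : T.circle = D • 𝟙 (𝟙_ C)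
  lollipop : T.lollipop = 0
  bigon : T.bigon = B • 𝟙 X
  triangle : T.triangle = (B / 2) • T.mul
  antisymmetry : (β_ X X).hom ≫ T.mul = -T.mul
  form_symmetry : T.cup ≫ (β_ X X).hom = T.cup
  jacobi : T.drawI - T.drawH + T.symCrossX = 0
  exceptional :
    T.square = (B / 6) • (T.drawI + T.drawH)
      + (5 / 6 * (B ^ 2 / (2 + D))) • (T.cupcap + 𝟙 (X ⊗ X) + (β_ X X).hom)

end

/-! Everything takes place in the algebra `End (X ⊗ X)`, whose product `f * g` is `g ≫ f`. At `v =
1` the crossing σ fixes cup and cap and negates the vertex. Hence the vertex is invariant under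
bending, and the quarter turn ρ is a linear map exchanging 1 with U, I with H, σ with τ = σ⁻¹, and
fixing the square H². `JacobiAlgebra` records these facts, and the rest is linear algebra.

Bending bounds the dimension by 5, so 1, U, I, H, σ, τ satisfy a linear relation. Its sum and
difference with its rotation cannot both be trivial, and either one, if nontrivial, forces σ = τ
(`crossings_eq_of_symmetric`, `crossings_eq_of_antisymmetric`). Naturality of the braiding then
spreads symmetry from X to all objects.

Once σ = τ, comparing the two forms of the Jacobi relation gives α = 0, which is the classical
Jacobi relation. A second relation, among 1, U, I, H, σ, H², is rigid under multiplication by σ and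
rotation, except when I = (b/2)(1 − σ), which is treated by direct computation. Capping it off fixes
the last coefficient and shows d ≠ −2 (`square_eq`). -/

open BraidedCategory

noncomputable section

namespace TrivalentData

/-! ### Bending legs and the quarter turn -/

section Bending

variable {C : Type u} [Category.{w} C] [MonoidalCategory C] {X : C} (T : TrivalentData X)

lemma cup_cap_zigzag :
    X ◁ T.cup ≫ (α_ X X X).inv ≫ T.cap ▷ X = (ρ_ X).hom ≫ (λ_ X).inv :=
  T.dual.coevaluation_evaluation'

/-- Turn the second input into an output on the right. -/
def bendRight {Y Z : C} (g : Y ⊗ X ⟶ Z) : Y ⟶ Z ⊗ X :=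
  (ρ_ Y).inv ≫ Y ◁ T.cup ≫ (α_ Y X X).inv ≫ g ▷ X

/-- Turn the first output into an input on the left. -/
def bendLeft {Y Z : C} (f : Y ⟶ X ⊗ Z) : X ⊗ Y ⟶ Z :=
  X ◁ f ≫ (α_ X X Z).inv ≫ T.cap ▷ Z ≫ (λ_ Z).hom

/-- Turn the last output into an input on the right. -/
def unbendRight {Y Z : C} (f : Y ⟶ Z ⊗ X) : Y ⊗ X ⟶ Z :=
  f ▷ X ≫ (α_ Z X X).hom ≫ Z ◁ T.cap ≫ (ρ_ Z).hom

/-- Turn the first input into an output on the left. -/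
def unbendLeft {Y Z : C} (g : X ⊗ Y ⟶ Z) : Y ⟶ X ⊗ Z :=
  (λ_ Y).inv ≫ T.cup ▷ Y ≫ (α_ X X Y).hom ≫ X ◁ g

lemma comul_eq_bendRight : T.comul = T.bendRight T.mul := rfl

lemma unbendRight_bendRight {Y Z : C} (g : Y ⊗ X ⟶ Z) : T.unbendRight (T.bendRight g) = g := by
  let _ := T.dual
  exact (tensorRightHomEquiv Y X X Z).left_inv g

lemma bendRight_unbendRight {Y Z : C} (f : Y ⟶ Z ⊗ X) : T.bendRight (T.unbendRight f) = f := by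
  let _ := T.dual
  exact (tensorRightHomEquiv Y X X Z).right_inv f

lemma bendLeft_unbendLeft {Y Z : C} (g : X ⊗ Y ⟶ Z) : T.bendLeft (T.unbendLeft g) = g := by
  let _ := T.dual
  exact (tensorLeftHomEquiv Y X X Z).left_inv g

lemma unbendLeft_bendLeft {Y Z : C} (f : Y ⟶ X ⊗ Z) : T.unbendLeft (T.bendLeft f) = f := by
  let _ := T.dual
  exact (tensorLeftHomEquiv Y X X Z).right_inv f

lemma bendRight_comp {Y Z W : C} (g : Y ⊗ X ⟶ Z) (h : Z ⟶ W) :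
    T.bendRight (g ≫ h) = T.bendRight g ≫ h ▷ X := by
  simp [bendRight]

lemma bendLeft_comp {Y Z W : C} (f : Y ⟶ X ⊗ Z) (h : Z ⟶ W) :
    T.bendLeft (f ≫ X ◁ h) = T.bendLeft f ≫ h := by
  simp only [bendLeft, MonoidalCategory.whiskerLeft_comp, Category.assoc]
  rw [associator_inv_naturality_right_assoc, whisker_exchange_assoc, leftUnitor_naturality]

lemma bendLeft_comp_whiskerRight {Y Z W : C} (k : Y ⟶ X ⊗ Z) (f : X ⟶ X ⊗ W) :
    T.bendLeft (k ≫ f ▷ Z ≫ (α_ X W Z).hom) =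
      X ◁ k ≫ (α_ X X Z).inv ≫ T.bendLeft f ▷ Z := by
  simp only [bendLeft]
  monoidal

/-- The rotation of a morphism of `X ⊗ X` by a quarter turn. -/
def rotate (g : X ⊗ X ⟶ X ⊗ X) : X ⊗ X ⟶ X ⊗ X :=
  T.bendLeft (T.bendRight g ≫ (α_ X X X).hom)

lemma rotate_id : T.rotate (𝟙 (X ⊗ X)) = T.cupcap := by
  have h : T.bendLeft ((ρ_ X).inv ≫ X ◁ T.cup) = T.cap ≫ T.cup := by
    rw [bendLeft_comp]
    congr 1
    simp only [bendLeft]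
    monoidal
  simpa [rotate, bendRight, cupcap] using h

lemma bendRight_cap : T.bendRight T.cap = (λ_ X).inv := by
  rw [bendRight, cup_cap_zigzag]; simp

lemma rotate_cupcap : T.rotate T.cupcap = 𝟙 (X ⊗ X) := by
  have h := T.bendLeft_unbendLeft (𝟙 (X ⊗ X))
  simpa [rotate, cupcap, bendRight_comp, bendRight_cap, unbendLeft] using h

lemma bendRight_precomp {Y Y' Z : C} (f : Y' ⟶ Y) (g : Y ⊗ X ⟶ Z) :
    T.bendRight (f ▷ X ≫ g) = f ≫ T.bendRight g := by
  simp only [bendRight, comp_whiskerRight]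
  rw [rightUnitor_inv_naturality_assoc, ← whisker_exchange_assoc,
    associator_inv_naturality_left_assoc]

lemma bendRight_whiskerLeft (W : C) {Y Z : C} (g : Y ⊗ X ⟶ Z) :
    T.bendRight ((α_ W Y X).hom ≫ W ◁ g) = W ◁ T.bendRight g ≫ (α_ W Z X).inv := by
  simp only [bendRight]
  monoidal

lemma bendRight_drawH : T.bendRight T.drawH ≫ (α_ X X X).hom = T.comul ≫ X ◁ T.comul := by
  rw [drawH, bendRight_precomp, bendRight_whiskerLeft, ← comul_eq_bendRight]
  simp

/-- The vertex is recovered from `comul` by bending the left output, as soon as `comul` is also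
the left bend of the vertex. -/
lemma bendLeft_comul (h : T.unbendLeft T.mul = T.comul) : T.bendLeft T.comul = T.mul := by
  rw [← h, bendLeft_unbendLeft]

lemma unbendRight_comul : T.unbendRight T.comul = T.mul := by
  rw [comul_eq_bendRight, unbendRight_bendRight]

/-- The two vertices of H sit on disjoint strands, so the interchange law reverses their heights;
`h` then reads the left vertex's partner as a `comul`. -/
lemma drawH_eq (h : T.unbendLeft T.mul = T.comul) :
    T.drawH = X ◁ T.comul ≫ (α_ X X X).inv ≫ T.mul ▷ X := by
  calc T.drawH = 𝟙 _ ⊗≫ X ◁ T.cup ▷ X ⊗≫ (T.mul ▷ (X ⊗ X) ≫ X ◁ T.mul) ⊗≫ 𝟙 _ := by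
        simp only [drawH, comul]
        monoidal
    _ = 𝟙 _ ⊗≫ X ◁ T.cup ▷ X ⊗≫ ((X ⊗ X) ◁ T.mul ≫ T.mul ▷ X) ⊗≫ 𝟙 _ := by
        rw [whisker_exchange]
    _ = X ◁ T.comul ≫ (α_ X X X).inv ≫ T.mul ▷ X := by
        rw [← h]
        simp only [unbendLeft]
        monoidal

lemma rotate_drawI (h : T.unbendLeft T.mul = T.comul) : T.rotate T.drawI = T.drawH := by
  rw [rotate, drawI, bendRight_comp, ← comul_eq_bendRight, Category.assoc,
    bendLeft_comp_whiskerRight, T.bendLeft_comul h, T.drawH_eq h]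

lemma rotate_drawH (h : T.unbendLeft T.mul = T.comul) : T.rotate T.drawH = T.drawI := by
  rw [rotate, bendRight_drawH, bendLeft_comp, T.bendLeft_comul h, drawI]

lemma rotate_square (h : T.unbendLeft T.mul = T.comul) : T.rotate T.square = T.square := by
  have e : T.bendRight T.square ≫ (α_ X X X).hom =
      (T.comul ≫ T.comul ▷ X ≫ (α_ X X X).hom) ≫ X ◁ T.drawH := by
    have e1 : T.bendRight T.drawH = T.comul ≫ X ◁ T.comul ≫ (α_ X X X).inv := by
      rw [← Category.assoc, ← bendRight_drawH]; simp
    rw [square, bendRight_comp, e1]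
    calc ((T.comul ≫ X ◁ T.comul ≫ (α_ X X X).inv) ≫ T.drawH ▷ X) ≫ (α_ X X X).hom
        = T.comul ≫ (X ◁ T.comul ≫ T.comul ▷ (X ⊗ X)) ⊗≫ X ◁ T.mul ▷ X ⊗≫ 𝟙 _ := by
          simp only [drawH]
          monoidal
      -- Two vertices on disjoint strands trade heights, so that the remaining ones form an H in the
      -- shape given by `drawH_eq`.
      _ = T.comul ≫ (T.comul ▷ X ≫ (X ⊗ X) ◁ T.comul) ⊗≫ X ◁ T.mul ▷ X ⊗≫ 𝟙 _ := by
          rw [whisker_exchange]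
      _ = _ := by
          rw [T.drawH_eq h]
          monoidal
  rw [rotate, e, bendLeft_comp, bendLeft_comp_whiskerRight, T.bendLeft_comul h, square]
  rw [← T.drawH_eq h]

lemma mul_cap_eq (h : T.unbendLeft T.mul = T.comul) :
    (α_ X X X).inv ≫ T.mul ▷ X ≫ T.cap = X ◁ T.mul ≫ T.cap := by
  calc (α_ X X X).inv ≫ T.mul ▷ X ≫ T.cap
      = 𝟙 _ ⊗≫ X ◁ T.comul ▷ X ⊗≫ (T.cap ▷ (X ⊗ X) ≫ 𝟙_ C ◁ T.cap) ⊗≫ 𝟙 _ := by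
        rw [← T.bendLeft_comul h]
        simp only [bendLeft]
        monoidal
    _ = 𝟙 _ ⊗≫ X ◁ T.comul ▷ X ⊗≫ ((X ⊗ X) ◁ T.cap ≫ T.cap ▷ 𝟙_ C) ⊗≫ 𝟙 _ := by
        rw [whisker_exchange]
    _ = X ◁ T.unbendRight T.comul ≫ T.cap := by
        simp only [unbendRight]
        monoidal
    _ = _ := by rw [unbendRight_comul]

lemma drawH_comp_cap (h : T.unbendLeft T.mul = T.comul) : T.drawH ≫ T.cap = X ◁ T.bigon ≫ T.cap := by
  rw [T.drawH_eq h, Category.assoc, Category.assoc, T.mul_cap_eq h, bigon]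
  simp

/-- The hypothesis slides a strand across the cap, turning c' into c; the cup left over from the
quarter turn is then pulled straight by the zig-zag identity. -/
lemma rotate_crossing {c c' : X ⊗ X ⟶ X ⊗ X}
    (h : X ◁ c' ≫ (α_ X X X).inv ≫ T.cap ▷ X =
      (α_ X X X).inv ≫ c ▷ X ≫ (α_ X X X).hom ≫ X ◁ T.cap ≫ (ρ_ X).hom ≫ (λ_ X).inv) :
    T.rotate c' = c := by
  calc T.rotate c'
      = 𝟙 _ ⊗≫ X ◁ X ◁ T.cup ⊗≫ (X ◁ c' ≫ (α_ X X X).inv ≫ T.cap ▷ X) ▷ X ⊗≫ 𝟙 _ := by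
        simp only [rotate, bendLeft, bendRight]
        monoidal
    _ = 𝟙 _ ⊗≫ ((X ⊗ X) ◁ T.cup ≫ c ▷ (X ⊗ X)) ⊗≫ X ◁ T.cap ▷ X ⊗≫ 𝟙 _ := by
        rw [h]
        monoidal
    _ = 𝟙 _ ⊗≫ (c ▷ (𝟙_ C) ≫ (X ⊗ X) ◁ T.cup) ⊗≫ X ◁ T.cap ▷ X ⊗≫ 𝟙 _ := by
        rw [whisker_exchange]
    _ = c ⊗≫ X ◁ (X ◁ T.cup ≫ (α_ X X X).inv ≫ T.cap ▷ X) ⊗≫ 𝟙 _ := by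
        monoidal
    _ = c := by
        rw [cup_cap_zigzag]
        monoidal

end Bending

/-! ### Rotation of crossings, linearity and the dimension bound -/

section Rotation

variable {C : Type u} [Category.{w} C] [MonoidalCategory C] [BraidedCategory C] {X : C}
  (T : TrivalentData X)

lemma rotate_braiding_inv : T.rotate (β_ X X).inv = (β_ X X).hom := by
  apply rotate_crossing
  have h := braiding_naturality_left T.cap X
  rw [braiding_tensor_left_hom, braiding_tensorUnit_left] at h
  rw [← cancel_mono ((λ_ X).hom ≫ (ρ_ X).inv)]
  simp only [Category.assoc]
  rw [h]
  simp

lemma rotate_braiding_hom : T.rotate (β_ X X).hom = (β_ X X).inv := by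
  apply rotate_crossing
  have h := braiding_inv_naturality_left T.cap X
  rw [braiding_tensor_right_inv, braiding_inv_tensorUnit_right] at h
  rw [← cancel_mono ((λ_ X).hom ≫ (ρ_ X).inv)]
  simp only [Category.assoc]
  rw [h]
  simp

end Rotation

section Linear

variable {C : Type u} [Category.{w} C] [MonoidalCategory C] [Preadditive C] [Linear ℂ C]
  [MonoidalPreadditive C] [MonoidalLinear ℂ C] {X : C}

/-- The quarter turn as a linear map. -/
def rotation (T : TrivalentData X) : (X ⊗ X ⟶ X ⊗ X) →ₗ[ℂ] (X ⊗ X ⟶ X ⊗ X) where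
  toFun := T.rotate
  map_add' := fun f g => by simp [rotate, bendLeft, bendRight]
  map_smul' := fun c f => by simp [rotate, bendLeft, bendRight]

/-- Bending both outputs down is linear, and injective because each bend can be undone. -/
lemma rank_end_le (T : TrivalentData X) :
    Module.rank ℂ (X ⊗ X ⟶ X ⊗ X) ≤ Module.rank ℂ (Box X 4) := by
  change Module.rank ℂ (X ⊗ X ⟶ X ⊗ X) ≤ Module.rank ℂ (X ⊗ X ⊗ X ⊗ X ⟶ 𝟙_ C)
  let φ : (X ⊗ X ⟶ X ⊗ X) →ₗ[ℂ] (X ⊗ X ⊗ X ⊗ X ⟶ 𝟙_ C) :=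
    { toFun := fun f => T.bendLeft (T.bendLeft f ≫ (ρ_ X).inv)
      map_add' := fun f g => by
        have h : ∀ {Y Z : C} (f g : Y ⟶ X ⊗ Z), T.bendLeft (f + g) = T.bendLeft f + T.bendLeft g :=
          fun f g => by simp [bendLeft]
        simp only [h, Preadditive.add_comp]
      map_smul' := fun c f => by
        have h : ∀ {Y Z : C} (c : ℂ) (f : Y ⟶ X ⊗ Z), T.bendLeft (c • f) = c • T.bendLeft f :=
          fun c f => by simp [bendLeft]
        simp only [h, Linear.smul_comp, RingHom.id_apply] }
  refine LinearMap.rank_le_of_injective φ fun f g hfg => ?_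
  have h1 := congrArg T.unbendLeft hfg
  simp only [φ, LinearMap.coe_mk, AddHom.coe_mk, unbendLeft_bendLeft] at h1
  rw [cancel_mono] at h1
  simpa only [unbendLeft_bendLeft] using congrArg T.unbendLeft h1

end Linear

section BraidedLinear

variable {C : Type u} [Category.{w} C] [MonoidalCategory C] [BraidedCategory C] [Preadditive C]
  [MonoidalPreadditive C] {X : C} (T : TrivalentData X)

/-- Sliding the strand across the cup on the left, and the crossing through the vertex on the right,
yields the same diagram up to one crossing below the vertex. That crossing gives the sign. -/
lemma unbendLeft_mul_eq (hmul : (β_ X X).hom ≫ T.mul = -T.mul)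
    (hcup : T.cup ≫ (β_ X X).hom = T.cup) :
    T.unbendLeft T.mul = -(T.comul ≫ (β_ X X).hom) := by
  have h1 : T.unbendLeft T.mul = (ρ_ X).inv ≫ X ◁ T.cup ≫ (α_ X X X).inv ≫ (β_ X X).hom ▷ X ≫
      (α_ X X X).hom ≫ X ◁ ((β_ X X).hom ≫ T.mul) := by
    have h := braiding_naturality_right X T.cup
    rw [braiding_tensor_right_hom, braiding_tensorUnit_right] at h
    rw [unbendLeft, ← cancel_epi ((ρ_ X).hom)]
    have h' := h =≫ ((α_ X X X).hom ≫ X ◁ T.mul)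
    simp only [Category.assoc, Iso.inv_hom_id_assoc, Iso.hom_inv_id_assoc,
      MonoidalCategory.whiskerLeft_comp] at h' ⊢
    exact h'.symm
  have h2 : T.comul ≫ (β_ X X).hom = (ρ_ X).inv ≫ X ◁ T.cup ≫ (α_ X X X).inv ≫
      (β_ X X).hom ▷ X ≫ (α_ X X X).hom ≫ X ◁ T.mul := by
    simp only [comul, Category.assoc]
    rw [braiding_naturality_left, braiding_tensor_left_hom]
    simp only [Category.assoc, Iso.inv_hom_id_assoc]
    rw [← MonoidalCategory.whiskerLeft_comp_assoc, hcup]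
  have h3 : X ◁ (-T.mul) = -(X ◁ T.mul) := (tensorLeft X).map_neg
  rw [h1, h2, hmul, h3]
  simp only [Preadditive.comp_neg]

end BraidedLinear

end TrivalentData

/-! ### From symmetry on X to symmetry of the whole category -/

section Symmetry

variable {C : Type u} [Category.{w} C] [MonoidalCategory C] [BraidedCategory C]

lemma double_braiding_unit_left (Y : C) : (β_ (𝟙_ C) Y).hom ≫ (β_ Y (𝟙_ C)).hom = 𝟙 _ := by
  simp

lemma double_braiding_tensor_left {Y Z W : C} (hY : (β_ Y W).hom ≫ (β_ W Y).hom = 𝟙 _)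
    (hZ : (β_ Z W).hom ≫ (β_ W Z).hom = 𝟙 _) :
    (β_ (Y ⊗ Z) W).hom ≫ (β_ W (Y ⊗ Z)).hom = 𝟙 _ := by
  simp only [braiding_tensor_left_hom, braiding_tensor_right_hom, Category.assoc,
    Iso.hom_inv_id_assoc]
  rw [← comp_whiskerRight_assoc, hY, id_whiskerRight, Category.id_comp, Iso.inv_hom_id_assoc,
    ← MonoidalCategory.whiskerLeft_comp_assoc, hZ]
  simp

lemma double_braiding_symm {Y Z : C} (h : (β_ Y Z).hom ≫ (β_ Z Y).hom = 𝟙 _) :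
    (β_ Z Y).hom ≫ (β_ Y Z).hom = 𝟙 _ := by
  have : (β_ Z Y).hom = (β_ Y Z).inv := by
    rw [← cancel_epi (β_ Y Z).hom, h, Iso.hom_inv_id]
  rw [this, Iso.inv_hom_id]

lemma double_braiding_word {X : C} (h : (β_ X X).hom ≫ (β_ X X).hom = 𝟙 _) (a b : TangleWord) :
    (β_ (a.obj X) (b.obj X)).hom ≫ (β_ (b.obj X) (a.obj X)).hom = 𝟙 _ := by
  have h1 : ∀ a : TangleWord, (β_ (a.obj X) X).hom ≫ (β_ X (a.obj X)).hom = 𝟙 _ := by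
    intro a
    induction a with
    | unit => exact double_braiding_unit_left X
    | strand => exact h
    | tensor a b ha hb => exact double_braiding_tensor_left ha hb
  induction a with
  | unit => exact double_braiding_unit_left _
  | strand => exact double_braiding_symm (h1 b)
  | tensor a b ha hb => exact double_braiding_tensor_left ha hb

lemma GeneratedByVertex.double_braiding [Preadditive C] [Linear ℂ C] [MonoidalPreadditive C]
    {X : C} {T : TrivalentData X} (hT : GeneratedByVertex T)
    (h : (β_ X X).hom ≫ (β_ X X).hom = 𝟙 _) (Y Z : C) :
    (β_ Y Z).hom ≫ (β_ Z Y).hom = 𝟙 (Y ⊗ Z) := by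
  obtain ⟨n, a, f, g, hfg⟩ := hT.objects Y
  obtain ⟨m, a', f', g', hfg'⟩ := hT.objects Z
  -- By naturality the double braiding can be moved between p ⊗ p' and q ⊗ q', where it acts on
  -- words and is trivial.
  have key : ∀ {A B : C} (p : Y ⟶ A) (q : A ⟶ Y) (p' : Z ⟶ B) (q' : B ⟶ Z),
      (β_ A B).hom ≫ (β_ B A).hom = 𝟙 _ →
      ((p ≫ q) ⊗ₘ (p' ≫ q')) ≫ (β_ Y Z).hom ≫ (β_ Z Y).hom = (p ≫ q) ⊗ₘ (p' ≫ q') := by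
    intro A B p q p' q' hAB
    rw [← tensorHom_comp_tensorHom]
    simp only [Category.assoc]
    rw [braiding_naturality_assoc, braiding_naturality, reassoc_of% hAB]
  have e : 𝟙 (Y ⊗ Z) = ∑ i, ∑ j, ((f i ≫ g i) ⊗ₘ (f' j ≫ g' j)) := by
    simp only [← tensor_sum, ← sum_tensor, hfg, hfg', id_tensorHom_id]
  rw [← Category.id_comp ((β_ Y Z).hom ≫ (β_ Z Y).hom), e]
  simp only [Preadditive.sum_comp]
  refine Finset.sum_congr rfl fun i _ => Finset.sum_congr rfl fun j _ => ?_
  exact key _ _ _ _ (double_braiding_word h _ _)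

end Symmetry

/-! ### The algebra of four-point diagrams: the crossings coincide -/

lemma exists_relation_of_rank_le_five {A : Type*} [AddCommGroup A] [Module ℂ A]
    (hA : Module.rank ℂ A ≤ 5) (a₀ a₁ a₂ a₃ a₄ a₅ : A) :
    ∃ x : Fin 6 → ℂ,
      (x 0 ≠ 0 ∨ x 1 ≠ 0 ∨ x 2 ≠ 0 ∨ x 3 ≠ 0 ∨ x 4 ≠ 0 ∨ x 5 ≠ 0) ∧
        x 0 • a₀ + x 1 • a₁ + x 2 • a₂ + x 3 • a₃ + x 4 • a₄ + x 5 • a₅ = 0 := by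
  have hdep : ¬ LinearIndependent ℂ ![a₀, a₁, a₂, a₃, a₄, a₅] := by
    intro hli
    have := hli.cardinal_lift_le_rank.trans (Cardinal.lift_le.mpr hA)
    simp at this
    norm_cast at this
  obtain ⟨x, hx, hne⟩ := Fintype.not_linearIndependent_iff.mp hdep
  simp only [Fin.sum_univ_succ, Fin.exists_fin_succ] at hx hne
  simp at hx hne
  refine ⟨x, by tauto, ?_⟩
  simpa only [add_assoc] using hx

/-- The multiplication table of the diagrams in the algebra of endomorphisms of `X ⊗ X`, where
`σ`, `τ` are the two crossings and `ρ` is the rotation by a quarter turn, together with the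
quantum exceptional Jacobi relation at `v = 1`. -/
structure JacobiAlgebra {A : Type*} [Ring A] [Algebra ℂ A] (U I H σ τ : A) (ρ : A →ₗ[ℂ] A)
    (α d b t : ℂ) : Prop where
  b_ne_zero : b ≠ 0
  I_ne_zero : I ≠ 0
  U_ne_zero : U ≠ 0
  σ_mul_τ : σ * τ = 1
  τ_mul_σ : τ * σ = 1
  σ_mul_U : σ * U = U
  U_mul_σ : U * σ = U
  σ_mul_I : σ * I = -I
  I_mul_σ : I * σ = -I
  U_mul_U : U * U = d • U
  I_mul_I : I * I = b • I
  U_mul_I : U * I = 0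
  I_mul_U : I * U = 0
  I_mul_H : I * H = t • I
  U_mul_H : U * H = b • U
  ρ_one : ρ 1 = U
  ρ_U : ρ U = 1
  ρ_I : ρ I = H
  ρ_H : ρ H = I
  ρ_σ : ρ σ = τ
  ρ_τ : ρ τ = σ
  ρ_square : ρ (H * H) = H * H
  jacobi : τ * H + I - H + α • (τ + U + 1) = 0

namespace JacobiAlgebra

variable {A : Type*} [Ring A] [Algebra ℂ A] {U I H σ τ : A} {ρ : A →ₗ[ℂ] A} {α d b t : ℂ}

lemma τ_mul_U (h : JacobiAlgebra U I H σ τ ρ α d b t) : τ * U = U := by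
  rw [← h.σ_mul_U, ← mul_assoc, h.τ_mul_σ, one_mul, h.σ_mul_U]

lemma U_mul_τ (h : JacobiAlgebra U I H σ τ ρ α d b t) : U * τ = U := by
  rw [← h.U_mul_σ, mul_assoc, h.σ_mul_τ, mul_one, h.U_mul_σ]

lemma τ_mul_I (h : JacobiAlgebra U I H σ τ ρ α d b t) : τ * I = -I := by
  rw [← neg_eq_iff_eq_neg, ← mul_neg, ← h.σ_mul_I, ← mul_assoc, h.τ_mul_σ, one_mul]

lemma I_mul_τ (h : JacobiAlgebra U I H σ τ ρ α d b t) : I * τ = -I := by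
  rw [← neg_eq_iff_eq_neg, ← neg_mul, ← h.I_mul_σ, mul_assoc, h.σ_mul_τ, mul_one]

lemma τ_mul_H (h : JacobiAlgebra U I H σ τ ρ α d b t) : τ * H = H - I - α • (τ + U + 1) := by
  linear_combination (norm := module) h.jacobi

/-- Together with `τ_mul_H` this gives (σ − τ)H = α(2 + 2U + σ + τ), so σ − τ annihilates H as soon
as α = 0; it always annihilates U and I. -/
lemma σ_mul_H (h : JacobiAlgebra U I H σ τ ρ α d b t) : σ * H = H - I + α • (1 + U + σ) := by
  have e := congrArg (σ * ·) h.jacobi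
  simp only [mul_add, mul_sub, mul_smul_comm, ← mul_assoc, h.σ_mul_τ, h.σ_mul_I, h.σ_mul_U,
    one_mul, mul_one, mul_zero] at e
  linear_combination (norm := module) -e

/-- Composing a linear relation with the vertex. -/
lemma coeff_of_I_mul (h : JacobiAlgebra U I H σ τ ρ α d b t) {x₁ x₂ x₃ x₄ x₅ x₆ : ℂ}
    (r : x₁ • (1 : A) + x₂ • U + x₃ • I + x₄ • H + x₅ • σ + x₆ • τ = 0) :
    x₁ + x₃ * b + x₄ * t - x₅ - x₆ = 0 := by
  have e := congrArg (I * ·) r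
  simp only [mul_add, mul_smul_comm, h.I_mul_U, h.I_mul_I, h.I_mul_H, h.I_mul_σ, h.I_mul_τ,
    mul_one, mul_zero] at e
  have e' : (x₁ + x₃ * b + x₄ * t - x₅ - x₆) • I = 0 := by
    linear_combination (norm := module) e
  exact (smul_eq_zero.mp e').resolve_right h.I_ne_zero

/-- Composing a linear relation with the cap. -/
lemma coeff_of_U_mul (h : JacobiAlgebra U I H σ τ ρ α d b t) {x₁ x₂ x₃ x₄ x₅ x₆ : ℂ}
    (r : x₁ • (1 : A) + x₂ • U + x₃ • I + x₄ • H + x₅ • σ + x₆ • τ = 0) :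
    x₁ + x₂ * d + x₄ * b + x₅ + x₆ = 0 := by
  have e := congrArg (U * ·) r
  simp only [mul_add, mul_smul_comm, h.U_mul_U, h.U_mul_I, h.U_mul_H, h.U_mul_σ, h.U_mul_τ,
    mul_one, mul_zero] at e
  have e' : (x₁ + x₂ * d + x₄ * b + x₅ + x₆) • U = 0 := by
    linear_combination (norm := module) e
  exact (smul_eq_zero.mp e').resolve_right h.U_ne_zero

/-- Rotating a linear relation. -/
lemma rotate (h : JacobiAlgebra U I H σ τ ρ α d b t) {x₁ x₂ x₃ x₄ x₅ x₆ x₇ : ℂ}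
    (r : x₁ • (1 : A) + x₂ • U + x₃ • I + x₄ • H + x₅ • σ + x₆ • τ + x₇ • (H * H) = 0) :
    x₂ • (1 : A) + x₁ • U + x₄ • I + x₃ • H + x₆ • σ + x₅ • τ + x₇ • (H * H) = 0 := by
  have e := congrArg ρ r
  simp only [map_add, map_smul, map_zero, h.ρ_one, h.ρ_U, h.ρ_I, h.ρ_H, h.ρ_σ, h.ρ_τ,
    h.ρ_square] at e
  linear_combination (norm := module) e

/-- Multiplying the Jacobi relation by I cancels the α-term, because Iτ = −I and IU = 0. -/
lemma two_mul_t (h : JacobiAlgebra U I H σ τ ρ α d b t) : b - 2 * t = 0 := by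
  have e := congrArg (I * ·) h.jacobi
  simp only [mul_add, mul_sub, mul_smul_comm, ← mul_assoc, h.I_mul_τ, h.I_mul_I, h.I_mul_H,
    h.I_mul_U, neg_mul, mul_one, mul_zero] at e
  have e' : (b - 2 * t) • I = 0 := by
    linear_combination (norm := module) e
  exact (smul_eq_zero.mp e').resolve_right h.I_ne_zero

lemma α_mul (h : JacobiAlgebra U I H σ τ ρ α d b t) : α * (2 + d) = 0 := by
  have e := congrArg (U * ·) h.jacobi
  simp only [mul_add, mul_sub, mul_smul_comm, ← mul_assoc, h.U_mul_τ, h.U_mul_I, h.U_mul_H,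
    h.U_mul_U, mul_one, mul_zero] at e
  have e' : (α * (2 + d)) • U = 0 := by
    linear_combination (norm := module) e
  exact (smul_eq_zero.mp e').resolve_right h.U_ne_zero

/-- If the sum vanished, multiplying by H would give bU − I + 2H = 0. Rotating this and composing
with I leaves 3b − t = 5b/2 = 0. -/
lemma one_add_U_add_σ_ne_zero (h : JacobiAlgebra U I H σ τ ρ α d b t) : 1 + U + σ ≠ 0 := by
  intro e
  have e1 := congrArg (· * H) e
  simp only [add_mul, one_mul, h.U_mul_H, h.σ_mul_H, zero_mul] at e1
  have r : (0 : ℂ) • (1 : A) + b • U + (-1 : ℂ) • I + (2 : ℂ) • H + (0 : ℂ) • σ + (0 : ℂ) • τ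
      + (0 : ℂ) • (H * H) = 0 := by
    linear_combination (norm := module) e1 - α • e
  have r' := h.rotate r
  have e2 := h.coeff_of_I_mul (x₁ := b) (x₂ := 0) (x₃ := 2) (x₄ := -1) (x₅ := 0) (x₆ := 0) (by
    linear_combination (norm := module) r')
  apply h.b_ne_zero
  linear_combination (2 / 5 : ℂ) * e2 - (1 / 5 : ℂ) * h.two_mul_t

lemma crossings_eq_of_symmetric (h : JacobiAlgebra U I H σ τ ρ α d b t) {x y z : ℂ} (hne : x ≠ 0 ∨ y ≠ 0 ∨ z ≠ 0)
    (r : x • (1 + U) + y • (I + H) + z • (σ + τ) = 0) : σ = τ := by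
  have ht := h.two_mul_t
  have hb := h.b_ne_zero
  have eI : x + y * b + y * t - z - z = 0 := h.coeff_of_I_mul (x₂ := x) (by
    linear_combination (norm := module) r)
  have eU : x + x * d + y * b + z + z = 0 := h.coeff_of_U_mul (x₃ := y) (by
    linear_combination (norm := module) r)
  by_cases hz : z = 0
  · subst hz
    have hy : y ≠ 0 := by
      rintro rfl
      have : x = 0 := by linear_combination eI
      simp [this] at hne
    -- Subtracting the σ- and τ-multiples removes I and H; the result minus its own rotation is 2x(σ
    -- − τ) = 0.
    have r1 := congrArg (σ * ·) r
    have r2 := congrArg (τ * ·) r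
    simp only [mul_add, mul_smul_comm, h.σ_mul_U, h.σ_mul_I, h.σ_mul_H, h.τ_mul_U, h.τ_mul_I,
      h.τ_mul_H, mul_one, mul_zero, zero_smul, add_zero] at r1 r2
    have r3 : (2 * y * α) • (1 : A) + (2 * y * α) • U + (0 : ℂ) • I + (0 : ℂ) • H
        + (x + y * α) • σ + (y * α - x) • τ + (0 : ℂ) • (H * H) = 0 := by
      linear_combination (norm := module) r1 - r2
    have r4 := h.rotate r3
    have hx : x ≠ 0 := by
      intro hx
      apply mul_ne_zero hy hb
      linear_combination (2 / 3 : ℂ) * eI - (2 / 3 : ℂ) * hx + (1 / 3 : ℂ) * y * ht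
    have e : (2 * x) • (σ - τ) = 0 := by
      linear_combination (norm := module) r3 - r4
    exact sub_eq_zero.mp ((smul_eq_zero.mp e).resolve_left (mul_ne_zero two_ne_zero hx))
  -- Right multiplication by H turns the crossings into known diagrams and introduces H², which is
  -- fixed by rotation and so drops out of the difference with the rotated relation.
  · have r1 := congrArg (· * H) r
    simp only [add_mul, smul_mul_assoc, h.U_mul_H, h.I_mul_H, h.σ_mul_H, h.τ_mul_H, one_mul,
      zero_mul] at r1
    have r2 : (0 : ℂ) • (1 : A) + (x * b) • U + (y * t - 2 * z) • I + (x + 2 * z) • H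
        + (z * α) • σ + (-(z * α)) • τ + y • (H * H) = 0 := by
      linear_combination (norm := module) r1
    have r3 := h.rotate r2
    by_cases hy : y = 0
    · exfalso
      subst hy
      have r4 : (x * b) • (1 : A) + (x * b) • U + x • I + x • H
          + (0 : ℂ) • σ + (0 : ℂ) • τ = 0 := by
        linear_combination (norm := module) r2 + r3
      have e := h.coeff_of_I_mul r4
      have hx : x = 2 * z := by linear_combination eI
      apply mul_ne_zero hz hb
      linear_combination (1 / 5 : ℂ) * e - (1 / 2 : ℂ) * b * hx + (1 / 10 : ℂ) * x * ht
    -- Otherwise d = −2, and `eI + eU` reduces to y(2b + t) = 5yb/2 = 0.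
    · have hα : α = 0 := by
        rcases mul_eq_zero.mp h.α_mul with hα | hd
        · exact hα
        · exfalso
          apply mul_ne_zero hy hb
          linear_combination (2 / 5 : ℂ) * (eI + eU) - (2 / 5 : ℂ) * x * hd
            + (1 / 5 : ℂ) * y * ht
      subst hα
      have r4 : (-(x * b)) • (1 : A) + (x * b) • U + (y * t - 4 * z - x) • I
          + (-(y * t - 4 * z - x)) • H + (0 : ℂ) • σ + (0 : ℂ) • τ = 0 := by
        linear_combination (norm := module) r2 - r3
      have e := h.coeff_of_I_mul r4
      have hx : x = 2 * z - 3 / 2 * (b * y) := by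
        linear_combination eI + (1 / 2 : ℂ) * y * ht
      have hy' : b * y = 2 * z := by
        apply mul_left_cancel₀ hb
        have hx' := hx
        have : t = b / 2 := by linear_combination (-1 / 2 : ℂ) * ht
        subst this hx
        linear_combination (2 / 5 : ℂ) * e
      have hxz : x = -z := by linear_combination hx - (3 / 2 : ℂ) * hy'
      have e2 : (z * b) • (1 : A) + (-(z * b)) • U + (-(2 * z)) • I + (2 * z) • H = 0 := by
        have e3 : y * t = z := by linear_combination (1 / 2 : ℂ) * hy' - (1 / 2 : ℂ) * y * ht
        have e4 : y * t - 4 * z - x = -(2 * z) := by linear_combination e3 - hxz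
        rw [e4, hxz] at r4
        linear_combination (norm := module) r4
      -- With α = 0, σ − τ annihilates U, I and H, so only the coefficient of 1 survives.
      have e5 := congrArg ((σ - τ) * ·) e2
      simp only [mul_add, mul_smul_comm, sub_mul, h.σ_mul_U, h.σ_mul_I, h.σ_mul_H, h.τ_mul_U,
        h.τ_mul_I, h.τ_mul_H, mul_one, mul_zero] at e5
      have e6 : (z * b) • (σ - τ) = 0 := by
        linear_combination (norm := module) e5
      exact sub_eq_zero.mp ((smul_eq_zero.mp e6).resolve_left (mul_ne_zero hz hb))

lemma crossings_eq_of_antisymmetric (h : JacobiAlgebra U I H σ τ ρ α d b t) {x y z : ℂ} (hne : x ≠ 0 ∨ y ≠ 0 ∨ z ≠ 0)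
    (r : x • (1 - U) + y • (I - H) + z • (σ - τ) = 0) : σ = τ := by
  have hb := h.b_ne_zero
  have ht : t = b / 2 := by linear_combination (-1 / 2 : ℂ) * h.two_mul_t
  have eI := h.coeff_of_I_mul (x₁ := x) (x₂ := -x) (x₃ := y) (x₄ := -y) (x₅ := z) (x₆ := -z) (by
    linear_combination (norm := module) r)
  have eU := h.coeff_of_U_mul (x₁ := x) (x₂ := -x) (x₃ := y) (x₄ := -y) (x₅ := z) (x₆ := -z) (by
    linear_combination (norm := module) r)
  have hx : x = -(y * b / 2) := by linear_combination eI + y * ht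
  by_cases hy : y = 0
  · subst hy
    have hx : x = 0 := by linear_combination hx
    subst hx
    have hz : z ≠ 0 := by simpa using hne
    have e : z • (σ - τ) = 0 := by linear_combination (norm := module) r
    exact sub_eq_zero.mp ((smul_eq_zero.mp e).resolve_left hz)
  -- With x = −yb/2, the cap relation x(1 − d) = yb determines d; then α(2 + d) = 0 forces α = 0.
  · have hd : d = 3 := by
      apply mul_left_cancel₀ (mul_ne_zero hy hb)
      rw [hx] at eU
      linear_combination 2 * eU
    have hα : α = 0 := by
      have := h.α_mul
      rw [hd] at this
      linear_combination (1 / 5 : ℂ) * this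
    subst hα
    have r1 := congrArg (· * H) r
    simp only [add_mul, sub_mul, smul_mul_assoc, h.U_mul_H, h.I_mul_H, h.σ_mul_H, h.τ_mul_H,
      one_mul, zero_mul] at r1
    have r2 : (0 : ℂ) • (1 : A) + (-(x * b)) • U + (y * t) • I + x • H
        + (0 : ℂ) • σ + (0 : ℂ) • τ + (-y) • (H * H) = 0 := by
      linear_combination (norm := module) r1
    have r3 := h.rotate r2
    -- The relation and its rotation contain the same multiple of H², and σ − τ annihilates U, I and
    -- H; the difference is therefore xb(σ − τ).
    have r4 := congrArg ((σ - τ) * ·) r2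
    have r5 := congrArg ((σ - τ) * ·) r3
    simp only [mul_add, mul_smul_comm, sub_mul, h.σ_mul_U, h.σ_mul_I, h.σ_mul_H, h.τ_mul_U,
      h.τ_mul_I, h.τ_mul_H, mul_one, mul_zero] at r4 r5
    have e : (x * b) • (σ - τ) = 0 := by
      linear_combination (norm := module) r4 - r5
    refine sub_eq_zero.mp ((smul_eq_zero.mp e).resolve_left (mul_ne_zero ?_ hb))
    rw [hx]
    exact neg_ne_zero.mpr (div_ne_zero (mul_ne_zero hy hb) two_ne_zero)

lemma crossings_eq (h : JacobiAlgebra U I H σ τ ρ α d b t) (hA : Module.rank ℂ A ≤ 5) : σ = τ := by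
  obtain ⟨x, hne, hx⟩ := exists_relation_of_rank_le_five hA 1 U I H σ τ
  -- The zero multiple of H² only matches the shape expected by `rotate`.
  have r : x 0 • (1 : A) + x 1 • U + x 2 • I + x 3 • H + x 4 • σ + x 5 • τ
      + (0 : ℂ) • (H * H) = 0 := by
    linear_combination (norm := module) hx
  have r' := h.rotate r
  by_cases hs : x 0 + x 1 ≠ 0 ∨ x 2 + x 3 ≠ 0 ∨ x 4 + x 5 ≠ 0
  · refine h.crossings_eq_of_symmetric hs ?_
    linear_combination (norm := module) r + r'
  by_cases ha : x 0 - x 1 ≠ 0 ∨ x 2 - x 3 ≠ 0 ∨ x 4 - x 5 ≠ 0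
  · refine h.crossings_eq_of_antisymmetric ha ?_
    linear_combination (norm := module) r - r'
  push Not at hs ha
  obtain ⟨s0, s1, s2⟩ := hs
  obtain ⟨a0, a1, a2⟩ := ha
  exfalso
  have e0 : x 0 = 0 := by linear_combination (1 / 2 : ℂ) * (s0 + a0)
  have e1 : x 1 = 0 := by linear_combination (1 / 2 : ℂ) * (s0 - a0)
  have e2 : x 2 = 0 := by linear_combination (1 / 2 : ℂ) * (s1 + a1)
  have e3 : x 3 = 0 := by linear_combination (1 / 2 : ℂ) * (s1 - a1)
  have e4 : x 4 = 0 := by linear_combination (1 / 2 : ℂ) * (s2 + a2)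
  have e5 : x 5 = 0 := by linear_combination (1 / 2 : ℂ) * (s2 - a2)
  rcases hne with h | h | h | h | h | h <;> contradiction

/-! ### The symmetric case and the square relation -/

lemma α_eq_zero (h : JacobiAlgebra U I H σ τ ρ α d b t) (hσ : σ = τ) : α = 0 := by
  have e : (2 * α) • (1 + U + σ) = 0 := by
    have e1 := h.σ_mul_H
    have e2 := h.τ_mul_H
    rw [← hσ] at e2
    linear_combination (norm := module) e2 - e1
  have e' := (smul_eq_zero.mp e).resolve_right h.one_add_U_add_σ_ne_zero
  linear_combination (1 / 2 : ℂ) * e'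

lemma σ_mul_H_of_symmetric (h : JacobiAlgebra U I H σ τ ρ α d b t) (hσ : σ = τ) : σ * H = H - I := by
  rw [h.σ_mul_H, h.α_eq_zero hσ, zero_smul, add_zero]

/-- The square relation in the case of the Lie algebra `so₃`. -/
lemma square_eq_of_I_eq (h : JacobiAlgebra U I H σ τ ρ α d b t) (hσ : σ = τ) (hI : I = (b / 2) • (1 - σ)) :
    2 + d ≠ 0 ∧ H * H = (b / 6) • (I + H) + (5 / 6 * (b ^ 2 / (2 + d))) • (U + 1 + σ) := by
  have hH : H = (b / 2) • (U - σ) := by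
    have e := congrArg ρ hI
    rwa [map_smul, map_sub, h.ρ_I, h.ρ_one, h.ρ_σ, ← hσ] at e
  have hd : d = 3 := by
    have e := h.coeff_of_U_mul (x₁ := 0) (x₂ := -(b / 2)) (x₃ := 0) (x₄ := 1) (x₅ := b / 2)
      (x₆ := 0) (by linear_combination (norm := module) hH)
    apply mul_left_cancel₀ h.b_ne_zero
    linear_combination -2 * e
  have hss : σ * σ = 1 := by
    nth_rw 2 [hσ]
    exact h.σ_mul_τ
  constructor
  · rw [hd]; norm_num
  · have e : H * H = (b / 2) • (b / 2) • (d • U - U - (U - 1)) := by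
      rw [hH]
      simp only [smul_mul_assoc, mul_smul_comm, sub_mul, mul_sub, h.U_mul_U, h.σ_mul_U, h.U_mul_σ,
        hss, smul_sub]
    rw [e, hI, hH, hd]
    module

/-- In the symmetric case, comparing a relation with its product with the crossing. -/
lemma I_eq_or_of_relation (h : JacobiAlgebra U I H σ τ ρ α d b t) (hσ : σ = τ) {x₁ x₂ x₃ x₄ x₅ x₆ : ℂ}
    (r : x₁ • (1 : A) + x₂ • U + x₃ • I + x₄ • H + x₅ • σ + x₆ • (H * H) = 0) :
    I = (b / 2) • (1 - σ) ∨ (x₁ = x₅ ∧ 2 * x₃ + x₄ + x₆ * t = 0) := by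
  have hss : σ * σ = 1 := by
    nth_rw 2 [hσ]
    exact h.σ_mul_τ
  have hsH := h.σ_mul_H_of_symmetric hσ
  have e := congrArg (σ * ·) r
  simp only [mul_add, mul_smul_comm, ← mul_assoc, h.σ_mul_U, h.σ_mul_I, hsH, hss, sub_mul,
    h.I_mul_H, mul_one, mul_zero] at e
  -- Since H − σH = I and H² − σH² = IH = tI, everything except 1 − σ and I cancels.
  have e1 : (x₁ - x₅) • (1 - σ) + (2 * x₃ + x₄ + x₆ * t) • I = 0 := by
    linear_combination (norm := module) r - e
  have e2 := h.coeff_of_I_mul (x₁ := x₁ - x₅) (x₂ := 0) (x₃ := 2 * x₃ + x₄ + x₆ * t) (x₄ := 0)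
    (x₅ := -(x₁ - x₅)) (x₆ := 0) (by linear_combination (norm := module) e1)
  by_cases hk : 2 * x₃ + x₄ + x₆ * t = 0
  · right
    refine ⟨?_, hk⟩
    rw [hk] at e2
    linear_combination (1 / 2 : ℂ) * e2
  · left
    have e3 : x₁ - x₅ = -(b / 2 * (2 * x₃ + x₄ + x₆ * t)) := by
      linear_combination (1 / 2 : ℂ) * e2
    rw [e3] at e1
    have e4 : (2 * x₃ + x₄ + x₆ * t) • (I - (b / 2) • (1 - σ)) = 0 := by
      linear_combination (norm := module) e1
    exact sub_eq_zero.mp ((smul_eq_zero.mp e4).resolve_left hk)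

/-- The Cvitanović–Vogel square relation. -/
lemma square_eq (h : JacobiAlgebra U I H σ τ ρ α d b t) (hA : Module.rank ℂ A ≤ 5) (hσ : σ = τ) :
    2 + d ≠ 0 ∧ H * H = (b / 6) • (I + H) + (5 / 6 * (b ^ 2 / (2 + d))) • (U + 1 + σ) := by
  have ht : t = b / 2 := by linear_combination (-1 / 2 : ℂ) * h.two_mul_t
  obtain ⟨x, hne, r⟩ := exists_relation_of_rank_le_five hA 1 U I H σ (H * H)
  have r' : x 1 • (1 : A) + x 0 • U + x 3 • I + x 2 • H + x 4 • σ + x 5 • (H * H) = 0 := by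
    have e := h.rotate (x₁ := x 0) (x₂ := x 1) (x₃ := x 2) (x₄ := x 3) (x₅ := x 4) (x₆ := 0)
      (x₇ := x 5) (by linear_combination (norm := module) r)
    rw [← hσ] at e
    linear_combination (norm := module) e
  rcases h.I_eq_or_of_relation hσ r with hI | ⟨e1, e2⟩
  · exact h.square_eq_of_I_eq hσ hI
  rcases h.I_eq_or_of_relation hσ r' with hI | ⟨e3, e4⟩
  · exact h.square_eq_of_I_eq hσ hI
  rw [ht] at e2 e4
  -- The constraints from the relation and its rotation form a 2×2 system with both unknowns equal,
  -- 3x = −x₅b/2.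
  have e5 : x 2 = -(x 5 * b / 6) := by linear_combination (2 / 3 : ℂ) * e2 - (1 / 3 : ℂ) * e4
  have e6 : x 3 = -(x 5 * b / 6) := by linear_combination (2 / 3 : ℂ) * e4 - (1 / 3 : ℂ) * e2
  rw [e1, e3, e5, e6] at r
  have hx : x 5 ≠ 0 := by
    intro hx
    rw [hx] at r e5 e6
    have e7 : x 4 • (1 + U + σ) = 0 := by linear_combination (norm := module) r
    have e8 := (smul_eq_zero.mp e7).resolve_right h.one_add_U_add_σ_ne_zero
    have e9 : x 2 = 0 := by linear_combination e5
    have e10 : x 3 = 0 := by linear_combination e6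
    rcases hne with h | h | h | h | h | h
    · exact h (e1.trans e8)
    · exact h (e3.trans e8)
    · exact h e9
    · exact h e10
    · exact h e8
    · exact h hx
  obtain ⟨y, hy⟩ : ∃ y, x 4 = -(x 5 * y) := ⟨-(x 4 / x 5), by field_simp⟩
  rw [hy] at r
  have e7 : x 5 • (H * H - ((b / 6) • (I + H) + y • (U + 1 + σ))) = 0 := by
    linear_combination (norm := module) r
  have e8 := sub_eq_zero.mp ((smul_eq_zero.mp e7).resolve_left hx)
  -- Capping off: UH² = b²U, U(I + H) = bU and U(U + 1 + σ) = (2 + d)U, so b² − b²/6 = y(2 + d).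
  have e9 : 5 / 6 * b ^ 2 = y * (2 + d) := by
    have e := congrArg (U * ·) e8
    simp only [← mul_assoc, mul_add, mul_smul_comm, smul_mul_assoc, h.U_mul_U, h.U_mul_I,
      h.U_mul_H, h.U_mul_σ, mul_one] at e
    have e' : (5 / 6 * b ^ 2 - y * (2 + d)) • U = 0 := by
      linear_combination (norm := module) e
    exact sub_eq_zero.mp ((smul_eq_zero.mp e').resolve_right h.U_ne_zero)
  have hd : 2 + d ≠ 0 := by
    intro hd
    rw [hd, mul_zero] at e9
    exact mul_ne_zero (by norm_num) (pow_ne_zero 2 h.b_ne_zero) e9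
  refine ⟨hd, ?_⟩
  rw [e8]
  congr 2
  field_simp
  linear_combination -6 * e9

end JacobiAlgebra

/-! ### The trivalent category satisfies the multiplication table -/

namespace IsTrivalentRibbon

variable {C : Type u} [Category.{w} C] [MonoidalCategory C] [BraidedCategory C]
  [RightRigidCategory C] [RibbonCategory C] [Preadditive C] [Linear ℂ C] [MonoidalPreadditive C]
  [MonoidalLinear ℂ C] {X : C} {T : TrivalentData X}

lemma id_unit_ne_zero (hT : IsTrivalentRibbon T) : 𝟙 (𝟙_ C) ≠ 0 := by
  intro h
  have := @hT.box_zero.1 0 1 (by change (0 : ℂ) • 𝟙 (𝟙_ C) = (1 : ℂ) • 𝟙 (𝟙_ C); simp [h])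
  exact zero_ne_one this

lemma mul_ne_zero (hT : IsTrivalentRibbon T) : T.mul ≠ 0 := by
  intro h
  have h0 : T.vertexBox = 0 := by
    change (α_ X X X).inv ≫ T.mul ▷ X ≫ T.cap = 0
    simp [h]
  have := @hT.box_three.1 0 1 (by simp [h0])
  exact zero_ne_one this

lemma id_ne_zero (hT : IsTrivalentRibbon T) : 𝟙 X ≠ 0 := by
  intro h
  apply hT.mul_ne_zero
  rw [← Category.comp_id T.mul, h, Limits.comp_zero]

lemma circle_coeff_ne_zero (hT : IsTrivalentRibbon T) {d : ℂ}
    (hd : T.circle = d • 𝟙 (𝟙_ C)) : d ≠ 0 := by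
  rintro rfl
  obtain ⟨d', hd', e⟩ := hT.circle_ne_zero
  rw [hd, zero_smul] at e
  exact (smul_ne_zero hd' hT.id_unit_ne_zero) e.symm

lemma bigon_coeff_ne_zero (hT : IsTrivalentRibbon T) {b : ℂ} (hb : T.bigon = b • 𝟙 X) :
    b ≠ 0 := by
  rintro rfl
  obtain ⟨b', hb', e⟩ := hT.bigon_ne_zero
  rw [hb, zero_smul] at e
  exact (smul_ne_zero hb' hT.id_ne_zero) e.symm

lemma exists_smul_cap (hT : IsTrivalentRibbon T) (f : X ⊗ X ⟶ 𝟙_ C) :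
    ∃ c : ℂ, f = c • T.cap := by
  obtain ⟨c, hc⟩ := hT.box_two.2 f
  exact ⟨c, hc.symm⟩

/-- Bending identifies this Hom space with the one-dimensional space 𝒞(3), with `comul`
corresponding to the vertex. -/
lemma exists_smul_comul (hT : IsTrivalentRibbon T) (f : X ⟶ X ⊗ X) :
    ∃ c : ℂ, f = c • T.comul := by
  let φ : (X ⊗ X ⟶ X) → (X ⊗ X ⊗ X ⟶ 𝟙_ C) := fun g => (α_ X X X).inv ≫ g ▷ X ≫ T.cap
  obtain ⟨c, hc⟩ := hT.box_three.2 (φ (T.unbendRight f))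
  have hc' : φ (c • T.mul) = φ (T.unbendRight f) := by
    rw [← hc]
    change _ = c • ((α_ X X X).inv ≫ T.mul ▷ X ≫ T.cap)
    simp [φ]
  have e : c • T.mul = T.unbendRight f := by
    have e1 : (c • T.mul) ▷ X ≫ T.cap = T.unbendRight f ▷ X ≫ T.cap := by
      simpa only [φ, cancel_epi] using hc'
    have e2 : ∀ g : X ⊗ X ⟶ X, T.bendRight (g ▷ X ≫ T.cap) = g ≫ (λ_ X).inv := by
      intro g
      rw [T.bendRight_precomp, T.bendRight_cap]
    have e3 := congrArg T.bendRight e1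
    rwa [e2, e2, cancel_mono] at e3
  refine ⟨c, ?_⟩
  rw [← T.bendRight_unbendRight f, ← e, T.comul_eq_bendRight]
  simp [TrivalentData.bendRight]

lemma jacobiAlgebra (hT : IsTrivalentRibbon T) {α d b t : ℂ}
    (hQ : QuantumExceptionalJacobi T 1 α d b t) :
    JacobiAlgebra (A := End (X ⊗ X)) T.cupcap T.drawI T.drawH (β_ X X).hom (β_ X X).inv
      T.rotation α d b t := by
  have hd := hT.circle_coeff_ne_zero hQ.elementary.circle
  have hb := hT.bigon_coeff_ne_zero hQ.elementary.bigon
  have hbig : T.comul ≫ T.mul = b • 𝟙 X := hQ.elementary.bigon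
  have hcirc : T.cup ≫ T.cap = d • 𝟙 (𝟙_ C) := hQ.elementary.circle
  have hlol : T.comul ≫ T.cap = 0 := hQ.elementary.lollipop
  have mul_s : (β_ X X).hom ≫ T.mul = -T.mul := by
    have e := hQ.elementary.twisted_vertex
    rw [TrivalentData.negCross, Iso.inv_comp_eq] at e
    simp only [one_pow, neg_smul, one_smul, Preadditive.comp_neg] at e
    rw [← neg_eq_iff_eq_neg]
    exact e.symm
  have cup_s : T.cup ≫ (β_ X X).hom = T.cup := by
    have e := hQ.elementary.twisted_cup
    rw [TrivalentData.negCross, Iso.comp_inv_eq] at e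
    simpa using e.symm
  have s_cap : (β_ X X).hom ≫ T.cap = T.cap := by
    obtain ⟨c, hc⟩ := hT.exists_smul_cap ((β_ X X).hom ≫ T.cap)
    have e : T.cup ≫ (β_ X X).hom ≫ T.cap = T.cup ≫ T.cap := by
      rw [← Category.assoc, cup_s]
    rw [hc, Linear.comp_smul, hcirc, smul_smul] at e
    have e' := smul_left_injective ℂ hT.id_unit_ne_zero e
    have : c = 1 := mul_right_cancel₀ hd (by simpa using e')
    rw [hc, this, one_smul]
  -- One-dimensionality gives a scalar; closing up to a bigon, with b ≠ 0, identifies it as −1.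
  have comul_s : T.comul ≫ (β_ X X).hom = -T.comul := by
    obtain ⟨c, hc⟩ := hT.exists_smul_comul (T.comul ≫ (β_ X X).hom)
    have e : (T.comul ≫ (β_ X X).hom) ≫ T.mul = -(T.comul ≫ T.mul) := by
      rw [Category.assoc, mul_s, Preadditive.comp_neg]
    rw [hc, Linear.smul_comp, hbig, smul_smul, ← neg_smul] at e
    have e' := smul_left_injective ℂ hT.id_ne_zero e
    have : c = -1 := mul_right_cancel₀ hb (by simpa using e')
    rw [hc, this, neg_smul, one_smul]
  have hbend : T.unbendLeft T.mul = T.comul := by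
    rw [T.unbendLeft_mul_eq mul_s cup_s, comul_s, neg_neg]
  have cup_mul : T.cup ≫ T.mul = 0 := by
    have e : T.cup ≫ T.mul = -(T.cup ≫ T.mul) := by
      conv_lhs => rw [← cup_s, Category.assoc, mul_s, Preadditive.comp_neg]
    have e' : (2 : ℂ) • (T.cup ≫ T.mul) = 0 := by
      linear_combination (norm := module) e
    exact (smul_eq_zero.mp e').resolve_left two_ne_zero
  have I_mul : T.drawI ≫ T.mul = b • T.mul := by
    rw [TrivalentData.drawI, Category.assoc, hbig, Linear.comp_smul, Category.comp_id]
  have U_cap : T.cupcap ≫ T.cap = d • T.cap := by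
    rw [TrivalentData.cupcap, Category.assoc, hcirc, Linear.comp_smul, Category.comp_id]
  have H_cap : T.drawH ≫ T.cap = b • T.cap := by
    rw [T.drawH_comp_cap hbend, hQ.elementary.bigon]
    simp
  have cap_ne : T.cap ≠ 0 := by
    intro h
    rw [h, Limits.comp_zero] at hcirc
    exact smul_ne_zero hd hT.id_unit_ne_zero hcirc.symm
  refine
    { b_ne_zero := hb
      I_ne_zero := fun h => smul_ne_zero hb hT.mul_ne_zero (I_mul.symm.trans ?_)
      U_ne_zero := fun h => smul_ne_zero hd cap_ne (U_cap.symm.trans ?_)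
      σ_mul_τ := (β_ X X).inv_hom_id
      τ_mul_σ := (β_ X X).hom_inv_id
      σ_mul_U := ?_
      U_mul_σ := ?_
      σ_mul_I := ?_
      I_mul_σ := ?_
      U_mul_U := ?_
      I_mul_I := ?_
      U_mul_I := ?_
      I_mul_U := ?_
      I_mul_H := ?_
      U_mul_H := ?_
      ρ_one := T.rotate_id
      ρ_U := T.rotate_cupcap
      ρ_I := T.rotate_drawI hbend
      ρ_H := T.rotate_drawH hbend
      ρ_σ := T.rotate_braiding_hom
      ρ_τ := T.rotate_braiding_inv
      ρ_square := T.rotate_square hbend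
      jacobi := ?_ }
  · change (T.drawI : X ⊗ X ⟶ X ⊗ X) = 0 at h
    rw [h, Limits.zero_comp]
  · change (T.cupcap : X ⊗ X ⟶ X ⊗ X) = 0 at h
    rw [h, Limits.zero_comp]
  · change (T.cap ≫ T.cup) ≫ (β_ X X).hom = T.cap ≫ T.cup
    rw [Category.assoc, cup_s]
  · change (β_ X X).hom ≫ T.cap ≫ T.cup = T.cap ≫ T.cup
    rw [← Category.assoc, s_cap]
  · change (T.mul ≫ T.comul) ≫ (β_ X X).hom = -(T.mul ≫ T.comul)
    rw [Category.assoc, comul_s, Preadditive.comp_neg]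
  · change (β_ X X).hom ≫ T.mul ≫ T.comul = -(T.mul ≫ T.comul)
    rw [← Category.assoc, mul_s, Preadditive.neg_comp]
  · change T.cupcap ≫ T.cap ≫ T.cup = d • (T.cap ≫ T.cup)
    rw [← Category.assoc, U_cap, Linear.smul_comp]
  · change T.drawI ≫ T.mul ≫ T.comul = b • (T.mul ≫ T.comul)
    rw [← Category.assoc, I_mul, Linear.smul_comp]
  · change (T.mul ≫ T.comul) ≫ T.cap ≫ T.cup = 0
    rw [Category.assoc, ← Category.assoc T.comul, hlol, Limits.zero_comp, Limits.comp_zero]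
  · change (T.cap ≫ T.cup) ≫ T.mul ≫ T.comul = 0
    rw [Category.assoc, ← Category.assoc T.cup, cup_mul, Limits.zero_comp, Limits.comp_zero]
  · change T.drawH ≫ T.mul ≫ T.comul = t • (T.mul ≫ T.comul)
    rw [← Category.assoc, ← Linear.smul_comp, ← hQ.elementary.triangle]
    rfl
  · change T.drawH ≫ T.cap ≫ T.cup = b • (T.cap ≫ T.cup)
    rw [← Category.assoc, H_cap, Linear.smul_comp]
  · have e := hQ.jacobi
    simp only [one_zpow, one_smul] at e
    exact e

end IsTrivalentRibbon

end

theorem corollary6p31 {C : Type u} [Category.{w} C] [MonoidalCategory C] [BraidedCategory C]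
    [RightRigidCategory C] [RibbonCategory C] [Preadditive C] [Linear ℂ C]
    [MonoidalPreadditive C] [MonoidalLinear ℂ C] {X : C} (T : TrivalentData X)
    (hT : IsTrivalentRibbon T) (hdim : Module.rank ℂ (Box X 4) ≤ 5)
    (α d b t : ℂ) (hQ : QuantumExceptionalJacobi T 1 α d b t) :
    (∀ Y Z : C, (β_ Y Z).hom ≫ (β_ Z Y).hom = 𝟙 (Y ⊗ Z)) ∧
      ClassicalExceptionalRelations T d b := by

  have h := hT.jacobiAlgebra hQ
  have hA : Module.rank ℂ (End (X ⊗ X)) ≤ 5 := T.rank_end_le.trans hdim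
  have hσ := h.crossings_eq hA
  obtain ⟨hd, hS⟩ := h.square_eq hA hσ
  have hσ' : (β_ X X).hom = (β_ X X).inv := hσ
  have ht : t = b / 2 := by linear_combination (-1 / 2 : ℂ) * h.two_mul_t
  have hss : (β_ X X).hom ≫ (β_ X X).hom = 𝟙 (X ⊗ X) := by
    nth_rw 2 [hσ']
    exact (β_ X X).hom_inv_id
  refine ⟨hT.generated.double_braiding hss, ?_⟩
  exact
    { B_ne_zero := h.b_ne_zero
      two_add_D_ne_zero := hd
      circle := hQ.elementary.circle
      lollipop := hQ.elementary.lollipop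
      bigon := hQ.elementary.bigon
      triangle := ht ▸ hQ.elementary.triangle
      antisymmetry := by
        rw [hσ']
        simpa [TrivalentData.negCross] using hQ.elementary.twisted_vertex
      form_symmetry := by
        rw [hσ']
        simpa [TrivalentData.negCross] using hQ.elementary.twisted_cup
      jacobi := by
        have e : T.drawH ≫ (β_ X X).hom = T.drawH - T.drawI := h.σ_mul_H_of_symmetric hσ
        rw [TrivalentData.symCrossX, e]
        abel
      exceptional := hS }
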